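/- Let $X$ be a smooth irreducible complex affine variety with coordinate ring $\mathbb C[X]$, let $\mathfrak a\subset\mathbb C[X]$ be an ideal, and let $P\in V(\mathfrak a)$ be a closed point, with local ring $\mathcal O_P$ and maximal ideal $\mathfrak m_P$. Then $$\operatorname{lct}_P(\mathfrak a)\ \le\ \operatorname{rk}^G(P,\mathfrak a),$$ where the two sides, both in $[0,\infty]$, are defined as follows. *Log canonical threshold.* If $\mathfrak a=(f_1,\dots,f_r)$, then $$\operatorname{lct}_P(\mathfrak a)=\sup\Big\{s>0\ \Big|\ \frac1{(\sum_{i=1}^r|f_i|^2)^s}\ \text{is integrable around }P\Big\},\qquad \sup\emptyset=0.$$ Here "integrable around $P$" means that the integral over some neighbourhood of $P$ in the classical topology is finite, with respect to Lebesgue measure in local holomorphic coordinates given by local parameters at $P$; the integrand is taken to be $\infty$ where all $f_i$ vanish. This does not depend on the coordinates or on the generators. *$G$-stable rank.* A system of local parameters at $P$ is a tuple $T=(x_1,\dots,x_n)$ of elements of $\mathfrak m_P$ whose images form a basis of $\mathfrak m_P/\mathfrak m_P^2$ (so $n=\dim X$). Every $f\in\mathcal O_P$ has a unique expansion as a convergent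 power series $f(x_1,\dots,x_n)\in\mathbb C\{x_1,\dots,x_n\}$. For $\lambda\in\mathbb Z_{\ge0}^n$ put $$\operatorname{val}^T_\lambda(f)=\sup\{k\in\mathbb Z_{\ge 0}\mid f(t^{\lambda_1}x_1,\dots,t^{\lambda_n}x_n)=t^k g(x_1,\dots,x_n,t)\text{ for some }g\in\mathbb C\{x_1,\dots,x_n,t\}\},$$ so that $\operatorname{val}^T_\lambda(0)=\infty$, and $\operatorname{ord}^T_\lambda(\mathfrak a)=\min\{\operatorname{val}^T_\lambda(f)\mid f\in\mathfrak a\}$. Then $$\operatorname{rk}^G(P,\mathfrak a)=\inf_T\ \inf_{\lambda\in\mathbb Z^n_{\ge0}}\ \frac{\sum_{i=1}^n\lambda_i}{\operatorname{ord}^T_\lambda(\mathfrak a)},$$ where $T$ runs over all systems of local parameters at $P$; a quotient with denominator $0$ (including $0/0$) counts as $\infty$, and a quotient with denominator $\infty$ (which occurs only for $\mathfrak a=0$) counts as $0$. -/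

import Mathlib

open scoped ENNReal Topology

noncomputable section

namespace GStable

/-! Throughout, `X = Spec R` for a smooth domain `R` over `ℂ`.  By the Nullstellensatz the closed
points of `X` are the `ℂ`-algebra homomorphisms `P : R →ₐ[ℂ] ℂ`, the value of `f` at `P` being
`P f`. -/

/-- The closed points of the affine variety with coordinate ring `R`. -/
def Point (R : Type*) [CommRing R] [Algebra ℂ R] : Type _ := R →ₐ[ℂ] ℂ

section

variable {R : Type*} [CommRing R] [Algebra ℂ R]

instance : FunLike (Point R) R ℂ := inferInstanceAs (FunLike (R →ₐ[ℂ] ℂ) R ℂ)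

instance : AlgHomClass (Point R) ℂ R ℂ := inferInstanceAs (AlgHomClass (R →ₐ[ℂ] ℂ) ℂ R ℂ)

instance : RingHomClass (Point R) R ℂ := inferInstanceAs (RingHomClass (R →ₐ[ℂ] ℂ) R ℂ)

/-- The classical (Euclidean) topology on the set of closed points: the coarsest one for which all
regular functions are continuous, i.e. the subspace topology for any closed embedding in `ℂ^N`. -/
instance : TopologicalSpace (Point R) :=
  TopologicalSpace.induced (fun (Q : Point R) (f : R) => Q f) inferInstance

instance (P : Point R) : (RingHom.ker P).IsPrime := RingHom.ker_isPrime P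

/-- The local ring `𝒪_P` of the variety at the closed point `P`. -/
abbrev LocalRingAt (P : Point R) : Type _ := Localization.AtPrime (RingHom.ker P)

/-- `x₁, …, xₙ ∈ 𝒪_P` is a system of local parameters at `P`: every `xᵢ` lies in `𝔪_P`, and the
images form a basis of `𝔪_P / 𝔪_P²`. -/
def IsLocalParameters (P : Point R) {n : ℕ} (x : Fin n → LocalRingAt P) : Prop :=
  ∃ hx : ∀ i, x i ∈ IsLocalRing.maximalIdeal (LocalRingAt P),
    LinearIndependent (IsLocalRing.ResidueField (LocalRingAt P))
      (fun i => (IsLocalRing.maximalIdeal (LocalRingAt P)).toCotangent ⟨x i, hx i⟩) ∧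
    Submodule.span (IsLocalRing.ResidueField (LocalRingAt P))
      (Set.range fun i =>
        (IsLocalRing.maximalIdeal (LocalRingAt P)).toCotangent ⟨x i, hx i⟩) = ⊤

/-- `f ∈ 𝒪_P` is regular at `Q` if `f = a / b` with `a, b ∈ R` and `b(Q) ≠ 0`. -/
def RegularAt (P : Point R) (f : LocalRingAt P) (Q : Point R) : Prop :=
  ∃ a b : R, Q b ≠ 0 ∧ algebraMap R (LocalRingAt P) b * f = algebraMap R (LocalRingAt P) a

open Classical in
/-- The value at `Q` of `f ∈ 𝒪_P`, namely `a(Q) / b(Q)` if `f = a / b` with `b(Q) ≠ 0`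
(the junk value `0` where `f` is not regular). -/
def evalAt (P : Point R) (f : LocalRingAt P) (Q : Point R) : ℂ :=
  if h : RegularAt P f Q then Q h.choose / Q h.choose_spec.choose else 0

/-- The value does not depend on the fraction. -/
theorem evalAt_eq [IsDomain R] {P Q : Point R} {f : LocalRingAt P} {a b : R} (hb : Q b ≠ 0)
    (h : algebraMap R (LocalRingAt P) b * f = algebraMap R (LocalRingAt P) a) :
    evalAt P f Q = Q a / Q b := by
  have hr : RegularAt P f Q := ⟨a, b, hb, h⟩
  have hs := hr.choose_spec.choose_spec
  rw [evalAt, dif_pos hr, div_eq_div_iff hs.1 hb, ← map_mul, ← map_mul]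
  congr 1
  apply IsLocalization.injective (LocalRingAt P)
    (Ideal.primeCompl_le_nonZeroDivisors (RingHom.ker P))
  rw [map_mul, map_mul]
  linear_combination algebraMap R (LocalRingAt P) hr.choose_spec.choose * h -
    algebraMap R (LocalRingAt P) b * hs.2

/-! ### Convergent power series, valuations and orders -/

/-- `F ∈ ℂ{z}`: the power series `F` converges absolutely on some polydisc around `0`. -/
def IsConvergent {σ : Type*} (F : MvPowerSeries σ ℂ) : Prop :=
  ∃ r : ℝ, 0 < r ∧ Summable fun d : σ →₀ ℕ => ‖MvPowerSeries.coeff d F‖ * r ^ d.degree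

/-- For a weight `w = (λ₁, …, λₙ)`, the valuation of the convergent power series `F`: the largest
`k` with `F(t^λ₁ x₁, …, t^λₙ xₙ) = t^k g(x₁, …, xₙ, t)` for a convergent power series `g`
(and `∞` if `F = 0`).  The variable `t` is indexed by `none`, and `xᵢ` by `some i`. -/
def seriesVal {n : ℕ} (w : Fin n → ℕ) (F : MvPowerSeries (Fin n) ℂ) : ℕ∞ :=
  ⨆ (k : ℕ) (_ : ∃ g : MvPowerSeries (Option (Fin n)) ℂ, IsConvergent g ∧
    MvPowerSeries.subst
      (fun i => (MvPowerSeries.X none ^ w i * MvPowerSeries.X (some i) :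
        MvPowerSeries (Option (Fin n)) ℂ)) F = MvPowerSeries.X none ^ k * g), (k : ℕ∞)

/-- `F ∈ ℂ{x₁, …, xₙ}` is the expansion of `f ∈ 𝒪_P` in the local parameters `x₁, …, xₙ`: for `Q`
near `P` in the classical topology, `f(Q)` is the sum of `F` at `(x₁(Q), …, xₙ(Q))`. -/
def IsExpansion (P : Point R) {n : ℕ} (x : Fin n → LocalRingAt P) (f : LocalRingAt P)
    (F : MvPowerSeries (Fin n) ℂ) : Prop :=
  IsConvergent F ∧ ∀ᶠ Q in 𝓝 P,
    HasSum (fun d : Fin n →₀ ℕ => MvPowerSeries.coeff d F * ∏ i, evalAt P (x i) Q ^ d i)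
      (evalAt P f Q)

/-- The valuation of `f ∈ 𝒪_P` with respect to the local parameters `x` and the weight `w`: the
valuation of its expansion `F`.  As `F` exists and is unique, the supremum is over one element. -/
def val (P : Point R) {n : ℕ} (x : Fin n → LocalRingAt P) (w : Fin n → ℕ)
    (f : LocalRingAt P) : ℕ∞ :=
  ⨆ (F : MvPowerSeries (Fin n) ℂ) (_ : IsExpansion P x f F), seriesVal w F

/-- The order of the ideal `𝔞` with respect to `x` and `w`: the least valuation of its elements. -/
def order (P : Point R) {n : ℕ} (x : Fin n → LocalRingAt P) (w : Fin n → ℕ) (𝔞 : Ideal R) : ℕ∞ :=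
  ⨅ f ∈ 𝔞, val P x w (algebraMap R (LocalRingAt P) f)

/-- The slope `(∑ λᵢ) / ord`, where a slope with denominator `0` counts as `∞`. -/
def slope (P : Point R) {n : ℕ} (x : Fin n → LocalRingAt P) (w : Fin n → ℕ) (𝔞 : Ideal R) :
    ℝ≥0∞ :=
  if order P x w 𝔞 = 0 then ∞ else (∑ i, (w i : ℝ≥0∞)) / (order P x w 𝔞 : ℝ≥0∞)

/-- The `T`-stable rank of `𝔞` at `P`, where `T` is the system of local parameters `x`. -/
def stableRank (P : Point R) {n : ℕ} (x : Fin n → LocalRingAt P) (𝔞 : Ideal R) : ℝ≥0∞ :=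
  ⨅ w : Fin n → ℕ, slope P x w 𝔞

/-- The `G`-stable rank of `𝔞` at `P ∈ V(𝔞)`: the infimum of the `T`-stable ranks over all systems
`T` of local parameters at `P`.  (The number `n` of parameters is determined by `P`.) -/
def gStableRank (P : Point R) (𝔞 : Ideal R) : ℝ≥0∞ :=
  ⨅ (n : ℕ) (x : Fin n → LocalRingAt P) (_ : IsLocalParameters P x), stableRank P x 𝔞

/-! ### The log canonical threshold -/

/-- `e` is the holomorphic chart around `P` given by the local parameters `x`: its domain is an open
neighbourhood of `P` on which all `xᵢ` are regular, `e(Q) = (x₁(Q), …, xₙ(Q))` there, and `e` is a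
homeomorphism onto an open subset of `ℂⁿ` in which the regular functions on `X` become
holomorphic. -/
structure IsChart (P : Point R) {n : ℕ} (x : Fin n → LocalRingAt P)
    (e : OpenPartialHomeomorph (Point R) (Fin n → ℂ)) : Prop where
  mem_source : P ∈ e.source
  regularAt : ∀ Q ∈ e.source, ∀ i, RegularAt P (x i) Q
  apply_eq : ∀ Q ∈ e.source, ∀ i, e Q i = evalAt P (x i) Q
  analytic : ∀ f : R, AnalyticOnNhd ℂ (fun z => e.symm z f) e.target

/-- The function `h ≥ 0` on `X` is integrable around `P`: its integral is finite over the domain of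
some chart around `P` given by local parameters, for Lebesgue measure in the coordinates.  As
transition maps are biholomorphic, for continuous `h : X → [0, ∞]` this does not depend on the
local parameters. -/
def IntegrableAround (P : Point R) (h : Point R → ℝ≥0∞) : Prop :=
  ∃ (n : ℕ) (x : Fin n → LocalRingAt P) (e : OpenPartialHomeomorph (Point R) (Fin n → ℂ)),
    IsLocalParameters P x ∧ IsChart P x e ∧ ∫⁻ z in e.target, h (e.symm z) < ∞

/-- The log canonical threshold of `𝔞` at `P`: the supremum of the `s > 0` such that
`1 / (∑ |fᵢ|²)^s` is integrable around `P`, where `𝔞 = (f₁, …, f_r)`.  (Integrability does not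
depend on the choice of the generators.)  The integrand is `∞` where all `fᵢ` vanish. -/
def lct (P : Point R) (𝔞 : Ideal R) : ℝ≥0∞ :=
  ⨆ (s : ℝ) (_ : 0 < s ∧ ∃ (r : ℕ) (f : Fin r → R), Ideal.span (Set.range f) = 𝔞 ∧
    IntegrableAround P fun Q => ((∑ i, ‖Q (f i)‖ₑ ^ 2) ^ s)⁻¹), ENNReal.ofReal s

end

end GStable

end

open scoped ENNReal Topology NNReal

namespace GStable

/-! ### Coefficients and growth of power series of given weighted valuation -/

/-! The integral is tested on shrinking weighted polydiscs `|yᵢ| ≤ δ t ^ wᵢ`. If the order of the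
ideal exceeds `j`, every generator is `O(t ^ (j + 1))` there (`exists_sum_enorm_sq_le`), so the
integrand is at least a constant times `t ^ (-2 s (j + 1))`, while the polydisc has volume a
constant times `t ^ (2 ∑ wᵢ)`. A finite integral bounds the product as `t → 0`, forcing `s (j + 1) ≤
∑ wᵢ` (`mul_le_sum_of_lintegral_lt_top`).

The integral lives in a chart for parameters `x`, the polydiscs in other parameters `y`. By Nakayama
the `x` are combinations of the `y`, so the coordinate change has injective derivative
(`IsChart.exists_hasStrictFDerivAt`) and distorts volume by a bounded factor
(`exists_volume_image_le`). -/

theorem coeff_subst_weight {n : ℕ} (w : Fin n → ℕ) (F : MvPowerSeries (Fin n) ℂ)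
    (d : Fin n →₀ ℕ) :
    MvPowerSeries.coeff (Finsupp.single none (∑ i, w i * d i) + d.embDomain .some)
      (MvPowerSeries.subst
        (fun i => (MvPowerSeries.X none ^ w i * MvPowerSeries.X (some i) :
          MvPowerSeries (Option (Fin n)) ℂ)) F) = MvPowerSeries.coeff d F := by
  classical
  have hmon : ∀ d' : Fin n →₀ ℕ,
      (d'.prod fun i m => (MvPowerSeries.X none ^ w i * MvPowerSeries.X (some i) :
          MvPowerSeries (Option (Fin n)) ℂ) ^ m) =
        MvPowerSeries.monomial
          (Finsupp.single none (∑ i, w i * d' i) + d'.embDomain .some) 1 := by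
    intro d'
    have h1 : (Finsupp.single none (∑ i, w i * d' i) + d'.embDomain .some :
        Option (Fin n) →₀ ℕ) =
        ∑ i, d' i • (Finsupp.single none (w i) + Finsupp.single (some i) 1) := by
      ext j
      cases j with
      | none =>
        simp [Finsupp.finsetSum_apply, Finsupp.embDomain_of_notMem_range, mul_comm]
      | some j =>
        have := Finsupp.embDomain_apply_self (Function.Embedding.some) d' j
        simp only [Function.Embedding.some_apply] at this
        simp [Finsupp.finsetSum_apply, this, Finsupp.single_apply]
    rw [h1, Finsupp.prod_fintype _ _ (by simp)]
    have h2 : ∀ i, (MvPowerSeries.X none ^ w i * MvPowerSeries.X (some i) :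
        MvPowerSeries (Option (Fin n)) ℂ) =
        MvPowerSeries.monomial (Finsupp.single none (w i) + Finsupp.single (some i) 1) 1 := by
      intro i
      rw [MvPowerSeries.X_pow_eq, MvPowerSeries.X_def, MvPowerSeries.monomial_mul_monomial, one_mul]
    simp_rw [h2, MvPowerSeries.monomial_pow, one_pow]
    induction (Finset.univ : Finset (Fin n)) using Finset.induction_on with
    | empty => simp
    | insert a s ha ih =>
      rw [Finset.prod_insert ha, Finset.sum_insert ha, ih, MvPowerSeries.monomial_mul_monomial,
        one_mul]
  rw [MvPowerSeries.coeff_subst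
    (MvPowerSeries.hasSubst_of_constantCoeff_zero (by intro i; simp)), finsum_eq_single _ d]
  · rw [hmon, MvPowerSeries.coeff_monomial_same, smul_eq_mul, mul_one]
  -- No cancellation occurs: the `some` components of the new exponent recover the old one.
  · intro d' hd'
    rw [hmon, MvPowerSeries.coeff_monomial_ne, smul_zero]
    intro h
    apply hd'
    ext j
    have hj := DFunLike.congr_fun h (some j)
    have e1 := Finsupp.embDomain_apply_self (Function.Embedding.some) d' j
    have e2 := Finsupp.embDomain_apply_self (Function.Embedding.some) d j
    simp only [Function.Embedding.some_apply] at e1 e2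
    simpa [e1, e2] using hj.symm

/-- Divisibility by a power of `t` above `j` kills every monomial of lower `t`-degree; convergence
of the quotient plays no role. -/
theorem coeff_eq_zero_of_lt_seriesVal {n : ℕ} {w : Fin n → ℕ} {F : MvPowerSeries (Fin n) ℂ}
    {j : ℕ} (h : (j : ℕ∞) < seriesVal w F) {d : Fin n →₀ ℕ} (hd : ∑ i, w i * d i ≤ j) :
    MvPowerSeries.coeff d F = 0 := by
  classical
  obtain ⟨k, hk⟩ := lt_iSup_iff.1 h
  obtain ⟨⟨g, -, hg⟩, hk⟩ := lt_iSup_iff.1 hk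
  rw [← coeff_subst_weight w F d, hg, MvPowerSeries.X_pow_eq, MvPowerSeries.coeff_monomial_mul,
    if_neg]
  intro hle
  have := hle none
  rw [Finsupp.add_apply, Finsupp.embDomain_of_notMem_range _ _ _ (by simp)] at this
  simp only [Finsupp.single_eq_same, add_zero] at this
  have : j < k := by exact_mod_cast hk
  omega

/-- Growth of the sum of a power series on weighted polydiscs. -/
theorem norm_le_of_coeff_eq_zero {n : ℕ} {w : Fin n → ℕ} {F : MvPowerSeries (Fin n) ℂ} {j : ℕ}
    (h0 : ∀ d : Fin n →₀ ℕ, ∑ i, w i * d i ≤ j → MvPowerSeries.coeff d F = 0)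
    {r : ℝ} (hr : 0 ≤ r) (hF : Summable fun d : Fin n →₀ ℕ =>
      ‖MvPowerSeries.coeff d F‖ * r ^ d.degree)
    {t : ℝ} (ht0 : 0 ≤ t) (ht1 : t ≤ 1) {y : Fin n → ℂ} (hy : ∀ i, ‖y i‖ ≤ r * t ^ w i) {a : ℂ}
    (ha : HasSum (fun d : Fin n →₀ ℕ => MvPowerSeries.coeff d F * ∏ i, y i ^ d i) a) :
    ‖a‖ ≤ (∑' d : Fin n →₀ ℕ, ‖MvPowerSeries.coeff d F‖ * r ^ d.degree) * t ^ (j + 1) := by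
  rw [← ha.tsum_eq]
  refine tsum_of_norm_bounded (hF.hasSum.mul_right _) fun d => ?_
  by_cases hd : ∑ i, w i * d i ≤ j
  · rw [h0 d hd]; simp
  rw [norm_mul, norm_prod, mul_assoc]
  refine mul_le_mul_of_nonneg_left ?_ (norm_nonneg _)
  calc ∏ i, ‖y i ^ d i‖ ≤ ∏ i, (r * t ^ w i) ^ d i := by
        refine Finset.prod_le_prod (fun _ _ => norm_nonneg _) fun i _ => ?_
        rw [norm_pow]
        exact pow_le_pow_left₀ (norm_nonneg _) (hy i) _
    _ = r ^ d.degree * t ^ (∑ i, w i * d i) := by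
        simp_rw [mul_pow, Finset.prod_mul_distrib, ← pow_mul, Finset.prod_pow_eq_pow_sum]
        rw [Finsupp.degree_eq_sum]
    _ ≤ _ := mul_le_mul_of_nonneg_left (pow_le_pow_of_le_one ht0 ht1 (by omega))
        (pow_nonneg hr _)

/-! ### Local biholomorphisms and volume -/

/-- Close to its derivative, the map scales volume by at most any factor above `|det A|`.
Injectivity gives surjectivity of `A` in finite dimension, hence openness at `a`. -/
theorem exists_volume_image_le {E : Type*} [NormedAddCommGroup E] [NormedSpace ℝ E]
    [FiniteDimensional ℝ E] [MeasurableSpace E] [BorelSpace E] (μ : MeasureTheory.Measure E)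
    [μ.IsAddHaarMeasure] {Φ : E → E} {A : E →L[ℝ] E} {a : E} (hΦ : HasStrictFDerivAt Φ A a)
    (hA : Function.Injective A) :
    ∃ m : ℝ≥0, ∀ U ∈ 𝓝 a, ∃ V ⊆ U, IsOpen V ∧ ContinuousOn Φ V ∧ Φ '' V ∈ 𝓝 (Φ a) ∧
      ∀ S ⊆ V, μ (Φ '' S) ≤ m * μ S := by
  refine ⟨(|A.det|).toNNReal + 1, fun U hU => ?_⟩
  have hm : ENNReal.ofReal |A.det| < ((|A.det|).toNNReal + 1 : ℝ≥0) := by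
    rw [ENNReal.ofReal]; exact_mod_cast lt_add_one _
  obtain ⟨δ, hδ, hδ0⟩ :=
    ((MeasureTheory.addHaar_image_le_mul_of_det_lt μ A hm).and self_mem_nhdsWithin).exists
  obtain ⟨s, hs, hsA⟩ := hΦ.approximates_deriv_on_nhds (Or.inr hδ0)
  obtain ⟨V, hV, hVo, haV⟩ := mem_nhds_iff.1 (Filter.inter_mem hU hs)
  have hVA := hsA.mono_set (hV.trans Set.inter_subset_right)
  refine ⟨V, hV.trans Set.inter_subset_left, hVo, hVA.continuousOn, ?_, fun S hS =>
    hδ S Φ (hVA.mono_set hS)⟩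
  have : CompleteSpace E := FiniteDimensional.complete ℝ E
  rw [← hΦ.map_nhds_eq_of_surj (LinearMap.range_eq_top.2
    (LinearMap.injective_iff_surjective.1 hA))]
  exact Filter.image_mem_map (hVo.mem_nhds haV)

theorem volume_weighted_polydisc {n : ℕ} (w : Fin n → ℕ) {r t : ℝ} (hr : 0 ≤ r) (ht : 0 ≤ t) :
    MeasureTheory.volume (Set.univ.pi fun i : Fin n => Metric.closedBall (0 : ℂ) (r * t ^ w i)) =
      ENNReal.ofReal ((r ^ 2 * Real.pi) ^ n * t ^ (2 * ∑ i, w i)) := by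
  rw [MeasureTheory.volume_pi_pi]
  have h : ∀ i, MeasureTheory.volume (Metric.closedBall (0 : ℂ) (r * t ^ w i)) =
      ENNReal.ofReal (r ^ 2 * Real.pi * (t ^ (2 * w i))) := by
    intro i
    rw [Complex.volume_closedBall, ← ENNReal.ofReal_coe_nnreal,
      ← ENNReal.ofReal_pow (by positivity), ← ENNReal.ofReal_mul (by positivity)]
    congr 1
    rw [NNReal.coe_real_pi]
    ring
  simp_rw [h]
  rw [← ENNReal.ofReal_prod_of_nonneg (fun i _ => by positivity), Finset.prod_mul_distrib,
    Finset.prod_pow_eq_pow_sum, ← Finset.mul_sum]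
  simp

/-- Comparison of powers near `0`. -/
theorem le_of_forall_rpow_le {c K α β : ℝ} (hc : 0 < c)
    (h : ∀ t : ℝ, 0 < t → t ≤ 1 → c * t ^ α ≤ K * t ^ β) : β ≤ α := by
  by_contra! hlt
  have ht : Filter.Tendsto (fun t : ℝ => K * t ^ (β - α)) (𝓝[>] 0) (𝓝 (K * 0)) := by
    refine Filter.Tendsto.const_mul K ?_
    have := (Real.continuousAt_rpow_const 0 (β - α) (Or.inr (by linarith))).tendsto
    rw [Real.zero_rpow (by linarith)] at this
    exact this.mono_left nhdsWithin_le_nhds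
  have hle : c ≤ K * 0 := by
    refine ge_of_tendsto ht ?_
    filter_upwards [Ioc_mem_nhdsGT (zero_lt_one (α := ℝ))] with t ht
    have hp := Real.rpow_pos_of_pos ht.1 α
    rw [Real.rpow_sub ht.1, ← mul_div_assoc, le_div_iff₀ hp]
    exact h t ht.1 ht.2
  linarith

/-! ### Values of germs near the base point -/

section Germs

variable {R : Type*} [CommRing R] [Algebra ℂ R]

theorem Point.continuous_apply (f : R) : Continuous fun Q : Point R => Q f :=
  (_root_.continuous_apply f).comp
    (continuous_induced_dom (f := fun (Q : Point R) (f : R) => Q f))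

theorem exists_fraction (P : Point R) (f : LocalRingAt P) :
    ∃ a b : R, P b ≠ 0 ∧ algebraMap R (LocalRingAt P) b * f = algebraMap R (LocalRingAt P) a := by
  obtain ⟨⟨a, b⟩, h⟩ := IsLocalization.surj (RingHom.ker P).primeCompl f
  exact ⟨a, b, fun hb => b.2 hb, by rw [mul_comm]; exact h⟩

theorem IsChart.tendsto_symm {P : Point R} {n : ℕ} {x : Fin n → LocalRingAt P}
    {e : OpenPartialHomeomorph (Point R) (Fin n → ℂ)} (he : IsChart P x e) :
    Filter.Tendsto e.symm (𝓝 (e P)) (𝓝 P) := by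
  have := e.symm.continuousAt (x := e P) (e.map_source he.mem_source)
  rwa [ContinuousAt, e.left_inv he.mem_source] at this

variable [IsDomain R]

theorem evalAt_algebraMap (P Q : Point R) (f : R) :
    evalAt P (algebraMap R (LocalRingAt P) f) Q = Q f := by
  rw [evalAt_eq (a := f) (b := 1) (by simp) (by simp)]
  simp

theorem evalAt_self_of_mem {P : Point R} {f : LocalRingAt P}
    (hf : f ∈ IsLocalRing.maximalIdeal (LocalRingAt P)) : evalAt P f P = 0 := by
  obtain ⟨a, b, hb, h⟩ := exists_fraction P f
  have ha : a ∈ RingHom.ker P := by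
    rw [← IsLocalization.AtPrime.to_map_mem_maximal_iff (LocalRingAt P) (RingHom.ker P), ← h]
    exact Ideal.mul_mem_left _ _ hf
  rw [evalAt_eq hb h, show P a = 0 from ha, zero_div]

/-- Because of the junk value, this is claimed only near `P`, where the finitely many chosen
denominators stay nonzero and fractions can be combined. -/
theorem eventually_evalAt_sum_mul {ι : Type*} (s : Finset ι) (P : Point R)
    (f g : ι → LocalRingAt P) :
    ∀ᶠ Q in 𝓝 P, evalAt P (∑ i ∈ s, f i * g i) Q = ∑ i ∈ s, evalAt P (f i) Q * evalAt P (g i) Q := by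
  classical
  choose a b hb h using fun i => exists_fraction P (f i)
  choose a' b' hb' h' using fun i => exists_fraction P (g i)
  have hne : ∀ᶠ Q : Point R in 𝓝 P, ∀ i ∈ s, Q (b i) ≠ 0 ∧ Q (b' i) ≠ 0 :=
    (Finset.eventually_all s).2 fun i _ =>
      ((Point.continuous_apply (b i)).continuousAt.eventually_ne (hb i)).and
        ((Point.continuous_apply (b' i)).continuousAt.eventually_ne (hb' i))
  filter_upwards [hne] with Q hQ
  have key : ∀ u ⊆ s, ∃ c d : R, Q d ≠ 0 ∧
      algebraMap R (LocalRingAt P) d * (∑ i ∈ u, f i * g i) = algebraMap R (LocalRingAt P) c ∧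
      Q c / Q d = ∑ i ∈ u, evalAt P (f i) Q * evalAt P (g i) Q := by
    intro u
    induction u using Finset.induction_on with
    | empty => exact fun _ => ⟨0, 1, by simp, by simp, by simp⟩
    | insert i u hi ih =>
      intro hu
      obtain ⟨c, d, hd, hcd, hv⟩ := ih ((Finset.subset_insert i u).trans hu)
      obtain ⟨hq, hq'⟩ := hQ i (hu (Finset.mem_insert_self i u))
      refine ⟨a i * a' i * d + c * (b i * b' i), b i * b' i * d, ?_, ?_, ?_⟩
      · simp only [map_mul]
        exact mul_ne_zero (mul_ne_zero hq hq') hd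
      · rw [Finset.sum_insert hi]
        simp only [map_mul, map_add]
        rw [← h i, ← h' i, ← hcd]
        ring
      · rw [Finset.sum_insert hi, ← hv, evalAt_eq hq (h i), evalAt_eq hq' (h' i)]
        simp only [map_mul, map_add]
        field_simp
  obtain ⟨c, d, hd, hcd, hv⟩ := key s subset_rfl
  rw [evalAt_eq hd hcd, hv]

theorem IsChart.analyticAt_evalAt {P : Point R} {n : ℕ} {x : Fin n → LocalRingAt P}
    {e : OpenPartialHomeomorph (Point R) (Fin n → ℂ)} (he : IsChart P x e) (f : LocalRingAt P) :
    AnalyticAt ℂ (fun z => evalAt P f (e.symm z)) (e P) := by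
  obtain ⟨a, b, hb, h⟩ := exists_fraction P f
  have hP := e.map_source he.mem_source
  have hq : AnalyticAt ℂ (fun z => e.symm z a / e.symm z b) (e P) := by
    refine (he.analytic a _ hP).div (he.analytic b _ hP) ?_
    rwa [e.left_inv he.mem_source]
  refine hq.congr ?_
  filter_upwards [he.tendsto_symm.eventually
    ((Point.continuous_apply b).continuousAt.eventually_ne hb)] with z hz
  exact (evalAt_eq hz h).symm

end Germs

/-! ### Change of local parameters -/

section Parameters

variable {R : Type*} [CommRing R] [Algebra ℂ R] {P : Point R}

theorem IsLocalParameters.card_eq {n n' : ℕ} {x : Fin n → LocalRingAt P}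
    {y : Fin n' → LocalRingAt P} (hx : IsLocalParameters P x) (hy : IsLocalParameters P y) :
    n = n' := by
  obtain ⟨hx, hxi, hxs⟩ := hx
  obtain ⟨hy, hyi, hys⟩ := hy
  simpa using mk_eq_mk_of_basis (Module.Basis.mk hxi hxs.ge) (Module.Basis.mk hyi hys.ge)

theorem IsLocalParameters.exists_eq_sum [IsNoetherianRing R] {n : ℕ} {y : Fin n → LocalRingAt P}
    (hy : IsLocalParameters P y) {f : LocalRingAt P}
    (hf : f ∈ IsLocalRing.maximalIdeal (LocalRingAt P)) :
    ∃ b : Fin n → LocalRingAt P, f = ∑ j, b j * y j := by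
  obtain ⟨hy, -, hys⟩ := hy
  have : IsNoetherianRing (LocalRingAt P) :=
    IsLocalization.isNoetherianRing (RingHom.ker P).primeCompl _ inferInstance
  rw [Set.range_comp' (IsLocalRing.maximalIdeal (LocalRingAt P)).toCotangent
    (fun i => (⟨y i, hy i⟩ : IsLocalRing.maximalIdeal (LocalRingAt P))),
    IsLocalRing.CotangentSpace.span_image_eq_top_iff] at hys
  have hmem : (⟨f, hf⟩ : IsLocalRing.maximalIdeal (LocalRingAt P)) ∈
      Submodule.span (LocalRingAt P)
        (Set.range fun i => (⟨y i, hy i⟩ : IsLocalRing.maximalIdeal (LocalRingAt P))) := by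
    rw [hys]; trivial
  obtain ⟨b, hb⟩ := (Submodule.mem_span_range_iff_exists_fun _).1 hmem
  refine ⟨b, ?_⟩
  have := congrArg Subtype.val hb
  simpa using this.symm

/-- Since `Φ a = 0`, differentiating the relation leaves `vᵢ = ∑ ψᵢⱼ(a) (A v)ⱼ`, so `A v = 0` forces
`v = 0`. -/
theorem injective_of_eventually_eq_sum_mul {n : ℕ} {Φ : (Fin n → ℂ) → (Fin n → ℂ)}
    {A : (Fin n → ℂ) →L[ℂ] (Fin n → ℂ)} {a : Fin n → ℂ} (hΦ : HasFDerivAt Φ A a) (h0 : Φ a = 0)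
    {ψ : Fin n → Fin n → (Fin n → ℂ) → ℂ} (hψ : ∀ i j, DifferentiableAt ℂ (ψ i j) a)
    (h : ∀ i, ∀ᶠ z in 𝓝 a, z i = ∑ j, ψ i j z * Φ z j) : Function.Injective A := by
  rw [injective_iff_map_eq_zero]
  intro v hv
  ext i
  have hs := HasFDerivAt.fun_sum (u := Finset.univ) fun j _ =>
    (hψ i j).hasFDerivAt.mul ((hasFDerivAt_pi'.1 hΦ) j)
  have hi : HasFDerivAt (fun z : Fin n → ℂ => z i) (ContinuousLinearMap.proj i) a :=
    (ContinuousLinearMap.proj (R := ℂ) (φ := fun _ : Fin n => ℂ) i).hasFDerivAt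
  have := DFunLike.congr_fun ((hi.congr_of_eventuallyEq
    ((h i).mono fun z hz => hz.symm)).unique hs) v
  simpa [h0, hv] using this

theorem IsChart.exists_hasStrictFDerivAt [IsDomain R] [IsNoetherianRing R] {n : ℕ}
    {x y : Fin n → LocalRingAt P} {e : OpenPartialHomeomorph (Point R) (Fin n → ℂ)}
    (he : IsChart P x e) (hx : IsLocalParameters P x) (hy : IsLocalParameters P y) :
    ∃ A : (Fin n → ℂ) →L[ℂ] (Fin n → ℂ), Function.Injective A ∧
      HasStrictFDerivAt (fun z j => evalAt P (y j) (e.symm z)) A (e P) := by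
  have hΦ : AnalyticAt ℂ (fun z j => evalAt P (y j) (e.symm z)) (e P) :=
    AnalyticAt.pi fun j => he.analyticAt_evalAt (y j)
  refine ⟨_, ?_, hΦ.hasStrictFDerivAt⟩
  choose b hb using fun i => hy.exists_eq_sum (hx.choose i)
  refine injective_of_eventually_eq_sum_mul hΦ.hasStrictFDerivAt.hasFDerivAt ?_
    (ψ := fun i j z => evalAt P (b i j) (e.symm z))
    (fun i j => (he.analyticAt_evalAt (b i j)).differentiableAt) fun i => ?_
  · ext j
    simp only [e.left_inv he.mem_source]
    exact evalAt_self_of_mem (hy.choose j)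
  · filter_upwards [he.tendsto_symm.eventually (eventually_evalAt_sum_mul Finset.univ P (b i) y),
      e.open_target.mem_nhds (e.map_source he.mem_source)] with z hz hzt
    rw [← hz, ← hb i, ← he.apply_eq _ (e.map_target hzt), e.right_inv hzt]

end Parameters

/-! ### Comparison of integrability with weighted orders -/

section Comparison

variable {R : Type*} [CommRing R] [Algebra ℂ R] {P : Point R}

/-- A supremum above `j` already produces an expansion, so existence and uniqueness of expansions
need no proof. -/
theorem exists_expansion_of_lt_val {n : ℕ} {y : Fin n → LocalRingAt P} {w : Fin n → ℕ}
    {f : LocalRingAt P} {j : ℕ} (h : (j : ℕ∞) < val P y w f) :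
    ∃ F, IsExpansion P y f F ∧
      ∀ d : Fin n →₀ ℕ, ∑ i, w i * d i ≤ j → MvPowerSeries.coeff d F = 0 := by
  obtain ⟨F, h⟩ := lt_iSup_iff.1 h
  obtain ⟨hF, h⟩ := lt_iSup_iff.1 h
  exact ⟨F, hF, fun d hd => coeff_eq_zero_of_lt_seriesVal h hd⟩

variable [IsDomain R]

/-- A finite family of regular functions of positive weighted valuation is `O(t ^ (j + 1))` on the
polydiscs `{|yᵢ| ≤ ρ t ^ wᵢ}`. -/
theorem exists_sum_enorm_sq_le {n r : ℕ} {y : Fin n → LocalRingAt P} {w : Fin n → ℕ}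
    {f : Fin r → R} {j : ℕ}
    (h : ∀ i, (j : ℕ∞) < val P y w (algebraMap R (LocalRingAt P) (f i))) :
    ∃ C : ℝ, 0 < C ∧ ∃ ρ : ℝ, 0 < ρ ∧ ∀ᶠ Q in 𝓝 P, ∀ t : ℝ, 0 < t → t ≤ 1 →
      (∀ i, ‖evalAt P (y i) Q‖ ≤ ρ * t ^ w i) →
      ∑ i, ‖Q (f i)‖ₑ ^ 2 ≤ ENNReal.ofReal (C * t ^ (2 * (j + 1))) := by
  choose F hF h0 using fun i => exists_expansion_of_lt_val (h i)
  choose R₀ hR₀ hsum using fun i => (hF i).1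
  set M : Fin r → ℝ := fun i => ∑' d : Fin n →₀ ℕ, ‖MvPowerSeries.coeff d (F i)‖ * R₀ i ^ d.degree
  obtain ⟨ρ, hρ, hρ0⟩ : ∃ ρ : ℝ, (∀ i, ρ < R₀ i) ∧ 0 < ρ := by
    have hev : ∀ᶠ ρ in 𝓝[>] (0 : ℝ), ∀ i, ρ < R₀ i := by
      rw [Filter.eventually_all]
      exact fun i => nhdsWithin_le_nhds (Iio_mem_nhds (hR₀ i))
    exact (hev.and self_mem_nhdsWithin).exists
  refine ⟨∑ i, M i ^ 2 + 1, by positivity, ρ, hρ0, ?_⟩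
  filter_upwards [Filter.eventually_all.2 fun i => (hF i).2] with Q hQ t ht0 ht1 hy
  have hbound : ∀ i, ‖Q (f i)‖ ≤ M i * t ^ (j + 1) := by
    intro i
    have hi := hQ i
    rw [evalAt_algebraMap] at hi
    refine norm_le_of_coeff_eq_zero (h0 i) (hR₀ i).le (hsum i) ht0.le ht1
      (fun l => (hy l).trans ?_) hi
    exact mul_le_mul_of_nonneg_right (hρ i).le (by positivity)
  have hQe : ∀ i, ‖Q (f i)‖ₑ ^ 2 = ENNReal.ofReal (‖Q (f i)‖ ^ 2) := fun i => by
    rw [← ofReal_norm, ENNReal.ofReal_pow (norm_nonneg _)]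
  simp_rw [hQe]
  rw [← ENNReal.ofReal_sum_of_nonneg fun _ _ => by positivity]
  refine ENNReal.ofReal_le_ofReal ?_
  calc ∑ i, ‖Q (f i)‖ ^ 2 ≤ ∑ i, (M i * t ^ (j + 1)) ^ 2 :=
        Finset.sum_le_sum fun i _ => pow_le_pow_left₀ (norm_nonneg _) (hbound i) 2
    _ = (∑ i, M i ^ 2) * t ^ (2 * (j + 1)) := by
        rw [Finset.sum_mul]
        exact Finset.sum_congr rfl fun i _ => by ring
    _ ≤ _ := mul_le_mul_of_nonneg_right (by linarith) (by positivity)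

theorem mul_le_sum_of_lintegral_lt_top [IsNoetherianRing R] {n r : ℕ}
    {x y : Fin n → LocalRingAt P} {e : OpenPartialHomeomorph (Point R) (Fin n → ℂ)}
    (hx : IsLocalParameters P x) (he : IsChart P x e) (hy : IsLocalParameters P y)
    {f : Fin r → R} {s : ℝ} (hs : 0 < s)
    (hint : ∫⁻ z in e.target, ((∑ i, ‖e.symm z (f i)‖ₑ ^ 2) ^ s)⁻¹ < ∞) {w : Fin n → ℕ} {j : ℕ}
    (h : ∀ i, (j : ℕ∞) < val P y w (algebraMap R (LocalRingAt P) (f i))) :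
    s * (j + 1) ≤ ∑ i, (w i : ℝ) := by
  obtain ⟨A, hA, hΦ⟩ := he.exists_hasStrictFDerivAt hx hy
  set Φ : (Fin n → ℂ) → (Fin n → ℂ) := fun z j => evalAt P (y j) (e.symm z) with hΦdef
  have hΦ0 : Φ (e P) = 0 := by
    ext i
    simp only [hΦdef, e.left_inv he.mem_source]
    exact evalAt_self_of_mem (hy.choose i)
  obtain ⟨m, hm⟩ := exists_volume_image_le MeasureTheory.volume
    (hΦ.restrictScalars ℝ) (A := A.restrictScalars ℝ) hA
  obtain ⟨C, hC, ρ, hρ, hev⟩ := exists_sum_enorm_sq_le h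
  obtain ⟨V, hVU, hVo, hΦc, hΦV, hvol⟩ := hm _ (Filter.inter_mem
    (e.open_target.mem_nhds (e.map_source he.mem_source)) (he.tendsto_symm.eventually hev))
  rw [hΦ0] at hΦV
  obtain ⟨ε, hε, hball⟩ := Metric.nhds_basis_closedBall.mem_iff.1 hΦV
  -- `δ ≤ ρ` serves the growth estimate; `δ ≤ ε` keeps the polydiscs inside `Φ '' V`.
  set δ := min ρ ε with hδ
  have hδ0 : 0 < δ := lt_min hρ hε
  set I := ∫⁻ z in e.target, ((∑ i, ‖e.symm z (f i)‖ₑ ^ 2) ^ s)⁻¹ with hI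
  have key : ∀ t : ℝ, 0 < t → t ≤ 1 → (δ ^ 2 * Real.pi) ^ n * t ^ (2 * ∑ i, w i) ≤
      m * (I.toReal * (C * t ^ (2 * (j + 1))) ^ s) := by
    intro t ht0 ht1
    set B := Set.univ.pi fun i : Fin n => Metric.closedBall (0 : ℂ) (δ * t ^ w i) with hB
    set S := V ∩ Φ ⁻¹' B with hS
    have hBc : IsClosed B := isClosed_set_pi fun _ _ => Metric.isClosed_closedBall
    have hSm : MeasurableSet S := by
      obtain ⟨u, hu, hu'⟩ := continuousOn_iff_isClosed.1 hΦc B hBc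
      rw [hS, Set.inter_comm, hu']
      exact hu.measurableSet.inter hVo.measurableSet
    have hBV : B ⊆ Φ '' S := by
      intro v hv
      have hv' : v ∈ Metric.closedBall (0 : Fin n → ℂ) ε := by
        rw [mem_closedBall_zero_iff, pi_norm_le_iff_of_nonneg hε.le]
        intro i
        have := mem_closedBall_zero_iff.1 (hv i trivial)
        calc ‖v i‖ ≤ δ * t ^ w i := this
          _ ≤ δ * 1 := by gcongr; exact pow_le_one₀ ht0.le ht1
          _ ≤ ε := by rw [mul_one]; exact min_le_right _ _
      obtain ⟨z, hz, rfl⟩ := hball hv'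
      exact ⟨z, ⟨hz, hv⟩, rfl⟩
    have hD0 : 0 < C * t ^ (2 * (j + 1)) := by positivity
    set D := ENNReal.ofReal ((C * t ^ (2 * (j + 1))) ^ s) with hD
    -- Chebyshev's inequality on the preimage of the polydisc; common zeros are harmless, the
    -- integrand being `∞` there.
    have hlow : D⁻¹ * MeasureTheory.volume S ≤ I := by
      rw [← MeasureTheory.setLIntegral_const]
      calc _ ≤ ∫⁻ z in S, ((∑ i, ‖e.symm z (f i)‖ₑ ^ 2) ^ s)⁻¹ := by
            refine MeasureTheory.setLIntegral_mono' hSm fun z hz => ?_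
            rw [hD, ← ENNReal.ofReal_rpow_of_pos hD0]
            refine ENNReal.inv_le_inv.2 (ENNReal.rpow_le_rpow ?_ hs.le)
            refine (hVU hz.1).2 t ht0 ht1 fun i => ?_
            exact (mem_closedBall_zero_iff.1 (hz.2 i trivial)).trans
              (mul_le_mul_of_nonneg_right (min_le_left _ _) (by positivity))
        _ ≤ I := MeasureTheory.lintegral_mono_set fun z hz => (hVU hz.1).1
    have hDpos : D ≠ 0 := by
      rw [hD, Ne, ENNReal.ofReal_eq_zero, not_le]; positivity
    have hSle : MeasureTheory.volume S ≤ I * D := by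
      rwa [← ENNReal.div_le_iff_le_mul (Or.inl hDpos) (Or.inl ENNReal.ofReal_ne_top),
        ENNReal.div_eq_inv_mul]
    have hfin : ENNReal.ofReal ((δ ^ 2 * Real.pi) ^ n * t ^ (2 * ∑ i, w i)) ≤ m * (I * D) := by
      rw [← volume_weighted_polydisc w hδ0.le ht0.le]
      exact (MeasureTheory.measure_mono hBV).trans
        ((hvol S Set.inter_subset_left).trans (mul_le_mul_right hSle _))
    have htop : (m : ℝ≥0∞) * (I * D) ≠ ∞ :=
      ENNReal.mul_ne_top ENNReal.coe_ne_top (ENNReal.mul_ne_top hint.ne ENNReal.ofReal_ne_top)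
    have := (ENNReal.ofReal_le_iff_le_toReal htop).1 hfin
    rwa [ENNReal.toReal_mul, ENNReal.toReal_mul, hD,
      ENNReal.toReal_ofReal (by positivity), ENNReal.coe_toReal] at this
  have := le_of_forall_rpow_le (c := (δ ^ 2 * Real.pi) ^ n) (K := m * (I.toReal * C ^ s))
    (α := (2 * ∑ i, w i : ℕ)) (β := (2 * (j + 1) : ℕ) * s) (by positivity) fun t ht0 ht1 => by
      refine (Eq.trans_le ?_ (key t ht0 ht1)).trans_eq ?_
      · rw [Real.rpow_natCast]
      · rw [Real.mul_rpow hC.le (by positivity), Real.rpow_mul ht0.le, Real.rpow_natCast]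
        ring
  push_cast at this
  linarith

end Comparison

end GStable

theorem theorem1p6 {R : Type*} [CommRing R] [IsDomain R] [Algebra ℂ R] [Algebra.Smooth ℂ R]
    (𝔞 : Ideal R) (P : GStable.Point R) (hP : ∀ f ∈ 𝔞, P f = 0) :
    GStable.lct P 𝔞 ≤ GStable.gStableRank P 𝔞 := by
  have : IsNoetherianRing R := Algebra.FiniteType.isNoetherianRing ℂ R
  refine iSup₂_le ?_
  rintro s ⟨hs, r, f, hspan, n, x, e, hx, he, hint⟩
  refine le_iInf fun n' => le_iInf fun y => le_iInf fun hy => le_iInf fun w => ?_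
  obtain rfl := hx.card_eq hy
  rw [GStable.slope]
  split_ifs with ho
  · exact le_top
  have key : ∀ j : ℕ, (j : ℕ∞) < GStable.order P y w 𝔞 → s * (j + 1) ≤ ∑ i, (w i : ℝ) :=
    fun j hj => GStable.mul_le_sum_of_lintegral_lt_top hx he hy hs hint fun i =>
      hj.trans_le (iInf₂_le (f i) (hspan ▸ Ideal.subset_span ⟨i, rfl⟩))
  rw [ENNReal.le_div_iff_mul_le (Or.inl (by simpa using ho))
    (Or.inr (ENNReal.sum_ne_top.2 fun _ _ => ENNReal.natCast_ne_top _))]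
  generalize GStable.order P y w 𝔞 = o at ho key
  induction o using ENat.recTopCoe with
  | top =>
    -- Infinite order would make `s (j + 1)` bounded over all `j`, which is absurd.
    obtain ⟨j, hj⟩ := exists_nat_gt ((∑ i, (w i : ℝ)) / s)
    rw [div_lt_iff₀ hs] at hj
    nlinarith [key j (ENat.natCast_lt_top j)]
  | coe k =>
    -- With `j = k - 1`, the strict bound `j < k` yields the sharp `s k ≤ ∑ wᵢ`.
    obtain ⟨j, rfl⟩ := Nat.exists_eq_succ_of_ne_zero (show k ≠ 0 by simpa using ho)
    have hj := key j (by exact_mod_cast j.lt_succ_self)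
    have h := ENNReal.ofReal_le_ofReal hj
    rw [ENNReal.ofReal_mul hs.le, ENNReal.ofReal_sum_of_nonneg fun _ _ => by positivity,
      show (j + 1 : ℝ) = ((j + 1 : ℕ) : ℝ) by push_cast; rfl] at h
    simpa only [ENNReal.ofReal_natCast, ENat.toENNReal_coe] using h
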